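/- \textbf{Theorem (Strong linkedness of the cube).} A polytope is the convex hull of a finite set of points in some $\mathbb{R}^n$. A \emph{$d$-cube} is any polytope that is combinatorially equivalent to the convex hull in $\mathbb{R}^d$ of the $2^d$ vectors $(\pm1,\ldots,\pm1)$, that is, whose face lattice (its faces, including the empty face and the polytope itself, ordered by inclusion) is isomorphic to that of this polytope. The graph of a polytope is the graph formed by its vertices and edges (its $0$- and $1$-dimensional faces). A graph $G$ is \emph{$k$-linked} if it has at least $2k$ vertices and, for all $2k$ distinct vertices $s_1,\ldots,s_k,t_1,\ldots,t_k$ of $G$, there are pairwise vertex-disjoint paths $L_1,\ldots,L_k$ in $G$ such that $L_i$ joins $s_i$ to $t_i$. A graph $G$ is \emph{strongly $k$-linked} if it has at least $2k+1$ vertices and, for every vertex $v$ of $G$, the graph $G-v$ is $k$-linked. For every $d\ge 1$, the graph of every $d$-cube is strongly $\lfloor d/2\rfloor$-linked. -/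

import Mathlib

namespace CubeLinkage

/-! ### Linkedness of graphs -/

/-- The graph `G` is `k`-linked: it has at least `2k` vertices, and any `2k` distinct vertices
`s 0, …, s (k-1), t 0, …, t (k-1)` admit pairwise vertex-disjoint paths joining each `s i`
to `t i`. -/
def IsLinked {V : Type*} (G : SimpleGraph V) (k : ℕ) : Prop :=
  ((2 * k : ℕ) : ℕ∞) ≤ ENat.card V ∧
    ∀ s t : Fin k → V, Function.Injective (Sum.elim s t) →
      ∃ p : ∀ i, G.Path (s i) (t i),
        ∀ i j, i ≠ j → List.Disjoint (p i).1.support (p j).1.support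

/-- The graph `G` is strongly `k`-linked: it has at least `2k + 1` vertices, and for every
vertex `v` the graph `G - v` is `k`-linked. -/
def IsStronglyLinked {V : Type*} (G : SimpleGraph V) (k : ℕ) : Prop :=
  ((2 * k + 1 : ℕ) : ℕ∞) ≤ ENat.card V ∧
    ∀ v : V, IsLinked (G.induce ({v}ᶜ : Set V)) k

/-! ### Polytopes, their faces and their graphs -/

/-- A (convex) polytope in `ℝⁿ`: the convex hull of a finite set of points. -/
def IsPolytope {n : ℕ} (P : Set (EuclideanSpace ℝ (Fin n))) : Prop :=
  ∃ X : Set (EuclideanSpace ℝ (Fin n)), X.Finite ∧ P = convexHull ℝ X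

/-- The faces of `P`: the empty face, `P` itself, and the intersections of `P` with its
supporting hyperplanes, that is, the sets of maximizers over `P` of linear functionals.
They are ordered by inclusion, which gives the face lattice of `P`. -/
abbrev Face {n : ℕ} (P : Set (EuclideanSpace ℝ (Fin n))) : Type :=
  {F : Set (EuclideanSpace ℝ (Fin n)) // IsExposed ℝ P F}

/-- The vertices of `P`: the points `v` such that `{v}` is a face of `P`. -/
abbrev Vertex {n : ℕ} (P : Set (EuclideanSpace ℝ (Fin n))) : Type :=
  {v : EuclideanSpace ℝ (Fin n) // IsExposed ℝ P {v}}

/-- The graph of `P`: two distinct vertices are adjacent when the segment between them is a face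
of `P`. The one-dimensional faces of a polytope are exactly these segments. -/
def graph {n : ℕ} (P : Set (EuclideanSpace ℝ (Fin n))) : SimpleGraph (Vertex P) where
  Adj u v := u ≠ v ∧ IsExposed ℝ P (segment ℝ u.1 v.1)
  symm := ⟨fun u v h => ⟨h.1.symm, segment_symm ℝ u.1 v.1 ▸ h.2⟩⟩
  loopless := ⟨fun _ h => h.1 rfl⟩

/-! ### Cubes -/

/-- The convex hull in `ℝᵈ` of the `2ᵈ` vectors `(±1, …, ±1)`. -/
def standardCube (d : ℕ) : Set (EuclideanSpace ℝ (Fin d)) :=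
  convexHull ℝ {x | ∀ i, x i = 1 ∨ x i = -1}

/-- A `d`-cube: a polytope combinatorially equivalent to the standard `d`-dimensional cube,
that is, one whose face lattice is isomorphic to that of the standard cube. -/
def IsCube {n : ℕ} (d : ℕ) (P : Set (EuclideanSpace ℝ (Fin n))) : Prop :=
  IsPolytope P ∧ Nonempty (Face P ≃o Face (standardCube d))

end CubeLinkage

namespace CubeLinkage

/-! ### Partial colourings, linkages, and gluing them in a prism. -/

section Linkages

open scoped Classical

variable {V W κ : Type*}

/-! Disjoint paths are encoded as colour classes: a linkage is an extension of a partial colouring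
in which the vertices of each colour in `R` are joined inside that colour, so disjointness is
automatic. A colour outside `R` marks an obstacle, a vertex to be avoided but not linked. The
statement suited to induction is `Linkable`: in the graph of the `d`-dimensional cube, any `d + 1`
coloured vertices, at least one of them an obstacle, can be linked (`linkable_cubeGraph`). Deleting
`v` amounts to making it the obstacle, and `2⌊d/2⌋ + 1 ≤ d + 1`.

For the induction, let `o` be an obstacle and `x` a coloured vertex nearest to it. Split the cube in
a direction where they differ, with `o` in the lower half. Both halves then contain coloured
vertices, and by minimality the projection of `x` to the lower half is uncoloured or is `o`. A pair
divided between the halves changes sides along a rung, at a place coloured in both halves, and the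
induction hypothesis is applied to each half (`links_prism`). The lower half has the obstacle `o`.
The upper half may have none; one is gained by letting one divided pair cross at its upper end or at
a neighbour of it (`exists_crossing_near`), so that its colour needs no linking above. What remains
is a count of coloured vertices, in `links_prism_of_linkable`; its critical case uses the choice of
`x`.

For a general `d`-cube, the lattice isomorphism matches vertices with sign vectors and carries the
edges of the standard cube to edges (`IsCube.exists_equiv`). A spanning subgraph is enough, since
further edges cannot destroy a linkage. -/

/-- `v` and `w` are joined by a walk of `G` all of whose vertices lie in `S`. -/
def JoinedWithin (G : SimpleGraph V) (S : Set V) (v w : V) : Prop :=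
  ∃ p : G.Walk v w, ∀ x ∈ p.support, x ∈ S

namespace JoinedWithin

variable {G : SimpleGraph V} {S : Set V} {u v w : V}

theorem refl (hv : v ∈ S) : JoinedWithin G S v v :=
  ⟨.nil, by simpa using hv⟩

theorem symm (h : JoinedWithin G S v w) : JoinedWithin G S w v := by
  obtain ⟨p, hp⟩ := h
  exact ⟨p.reverse, by simpa using hp⟩

theorem trans (h₁ : JoinedWithin G S u v) (h₂ : JoinedWithin G S v w) :
    JoinedWithin G S u w := by
  obtain ⟨p, hp⟩ := h₁
  obtain ⟨q, hq⟩ := h₂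
  refine ⟨p.append q, fun x hx => ?_⟩
  rcases SimpleGraph.Walk.mem_support_append_iff .. |>.1 hx with h | h
  exacts [hp x h, hq x h]

theorem of_adj (h : G.Adj v w) (hv : v ∈ S) (hw : w ∈ S) : JoinedWithin G S v w :=
  ⟨h.toWalk, by simp [hv, hw]⟩

theorem map {H : SimpleGraph W} {T : Set W} (φ : G →g H) (hφ : ∀ x ∈ S, φ x ∈ T)
    (h : JoinedWithin G S v w) : JoinedWithin H T (φ v) (φ w) := by
  obtain ⟨p, hp⟩ := h
  refine ⟨p.map φ, fun x hx => ?_⟩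
  rw [SimpleGraph.Walk.support_map, List.mem_map] at hx
  obtain ⟨y, hy, rfl⟩ := hx
  exact hφ y (hp y hy)

end JoinedWithin

/-- The partial colouring `f` extends to a partial colouring in which any two vertices to which
`f` gives the same colour in `R` are joined by a walk of that colour. -/
def Links (G : SimpleGraph V) (f : V → Option κ) (R : Set κ) : Prop :=
  ∃ c : V → Option κ, (∀ v i, f v = some i → c v = some i) ∧
    ∀ i ∈ R, ∀ v w, f v = some i → f w = some i → JoinedWithin G {x | c x = some i} v w

/-- Each colour of `R` is used at most twice by `f`. -/
def AtMostPairs (f : V → Option κ) (R : Set κ) : Prop :=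
  ∀ i ∈ R, ∀ x y z, f x = some i → f y = some i → f z = some i → x = y ∨ x = z ∨ y = z

/-- The set of coloured vertices. -/
noncomputable def coloured [Fintype V] (f : V → Option κ) : Finset V :=
  Finset.univ.filter fun v => f v ≠ none

theorem mem_coloured [Fintype V] {f : V → Option κ} {v : V} : v ∈ coloured f ↔ f v ≠ none := by
  simp [coloured]

/-- Partial colourings of at most `n` vertices can be linked, provided that some vertex has a
colour that need not be linked. -/
def Linkable (κ : Type*) [Fintype V] (G : SimpleGraph V) (n : ℕ) : Prop :=
  ∀ (f : V → Option κ) (R : Set κ), (coloured f).card ≤ n → AtMostPairs f R →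
    (∃ v, ∃ i ∉ R, f v = some i) → Links G f R

theorem Links.congr {G : SimpleGraph V} {H : SimpleGraph W} (e : V ≃ W)
    (he : ∀ x y, G.Adj x y → H.Adj (e x) (e y)) {f : W → Option κ} {R : Set κ}
    (h : Links G (f ∘ e) R) : Links H f R := by
  obtain ⟨c, hc, hj⟩ := h
  refine ⟨c ∘ e.symm, fun v i hv => hc _ _ (by simpa using hv), fun i hi v w hv hw => ?_⟩
  have := (hj i hi (e.symm v) (e.symm w) (by simpa using hv) (by simpa using hw)).map
    (T := {x | (c ∘ e.symm) x = some i}) ⟨e, fun {a b} h => he a b h⟩ (by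
      intro x hx
      simpa using hx)
  simpa using this

theorem links_of_subsingleton {G : SimpleGraph V} {f : V → Option κ} {R : Set κ}
    (h : ∀ i ∈ R, ∀ v w, f v = some i → f w = some i → v = w) : Links G f R :=
  ⟨f, fun _ _ h => h, fun i hi v w hv hw => h i hi v w hv hw ▸ .refl hv⟩

/-- No obstacle is needed here: if there is a pair to be linked, it exhausts the coloured vertices,
and its colour can be given to the whole connected graph. -/
theorem links_of_card_le_two [Fintype V] {G : SimpleGraph V} (hG : G.Preconnected)
    {f : V → Option κ} {R : Set κ} (h : (coloured f).card ≤ 2) : Links G f R := by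
  by_cases hs : ∀ i ∈ R, ∀ v w, f v = some i → f w = some i → v = w
  · exact links_of_subsingleton hs
  push Not at hs
  obtain ⟨i, -, v, w, hv, hw, hne⟩ := hs
  have key : ∀ x j, f x = some j → j = i := by
    intro x j hx
    by_contra hj
    have h3 : ({x, v, w} : Finset V) ⊆ coloured f := by
      intro y hy
      simp only [Finset.mem_insert, Finset.mem_singleton] at hy
      rcases hy with rfl | rfl | rfl <;> simp [mem_coloured, *]
    have hxv : x ≠ v := by rintro rfl; exact hj (by simpa [hv] using hx.symm)
    have hxw : x ≠ w := by rintro rfl; exact hj (by simpa [hw] using hx.symm)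
    have := Finset.card_le_card h3
    rw [Finset.card_eq_three.2 ⟨x, v, w, hxv, hxw, hne, rfl⟩] at this
    omega
  refine ⟨fun _ => some i, fun x j hx => by rw [key x j hx], fun j _ x y hx _ => ?_⟩
  obtain ⟨p⟩ := hG x y
  exact ⟨p, fun _ _ => by simp [key x j hx]⟩

/-- Below the maximal number of coloured vertices, the required obstacle can be created by colouring
a free vertex with a colour outside `R`. -/
theorem Linkable.links_of_card_lt [Fintype V] {G : SimpleGraph V} {n : ℕ}
    (hG : Linkable κ G n) {f : V → Option κ} {R : Set κ} (hf : (coloured f).card < n)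
    (hV : (coloured f).card < Fintype.card V) (hp : AtMostPairs f R) (hR : ∃ i, i ∉ R) :
    Links G f R := by
  obtain ⟨j, hj⟩ := hR
  obtain ⟨o, ho⟩ : ∃ o, o ∉ coloured f := by
    by_contra! h
    rw [Finset.eq_univ_iff_forall.2 h, Finset.card_univ] at hV
    omega
  have ho' : f o = none := by simpa [mem_coloured] using ho
  have hval : ∀ i ∈ R, ∀ x, Function.update f o (some j) x = some i → f x = some i := by
    intro i hi x hx
    by_cases hxo : x = o
    · subst hxo
      simp only [Function.update_self, Option.some.injEq] at hx
      exact absurd (hx ▸ hi) hj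
    · simpa [hxo] using hx
  have hext : ∀ x i, f x = some i → Function.update f o (some j) x = some i := by
    intro x i hx
    have : x ≠ o := by rintro rfl; simp [ho'] at hx
    simpa [this] using hx
  obtain ⟨c, hc, hl⟩ := hG (Function.update f o (some j)) R
    (by
      have : coloured (Function.update f o (some j)) ⊆ insert o (coloured f) := by
        intro x hx
        by_cases hxo : x = o <;> simp_all [mem_coloured]
      exact (Finset.card_le_card this).trans ((Finset.card_insert_le _ _).trans hf))
    (fun i hi x y z hx hy hz => hp i hi x y z (hval i hi x hx) (hval i hi y hy) (hval i hi z hz))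
    ⟨o, j, hj, by simp⟩
  exact ⟨c, fun x i hx => hc x i (hext x i hx),
    fun i hi v w hv hw => hl i hi v w (hext v i hv) (hext w i hw)⟩

/-! ### Linkages in prisms -/

/-- The prism over `G`. -/
abbrev prism (G : SimpleGraph V) : SimpleGraph (Bool × V) := (⊤ : SimpleGraph Bool) □ G

theorem JoinedWithin.prism {G : SimpleGraph V} {S : Set V} {v w : V} (b : Bool)
    {T : Set (Bool × V)} (hT : ∀ x ∈ S, (b, x) ∈ T) (h : JoinedWithin G S v w) :
    JoinedWithin (prism G) T (b, v) (b, w) :=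
  h.map (H := CubeLinkage.prism G)
    ⟨fun x => (b, x), fun {x y} h => by simpa [SimpleGraph.boxProd_adj] using h⟩ hT

theorem JoinedWithin.rung {G : SimpleGraph V} {v : V} {T : Set (Bool × V)}
    (h : ∀ b, (b, v) ∈ T) (b b' : Bool) : JoinedWithin (CubeLinkage.prism G) T (b, v) (b', v) := by
  by_cases hb : b = b'
  · subst hb; exact .refl (h b)
  · exact .of_adj (by simp [SimpleGraph.boxProd_adj, hb]) (h b) (h b')

/-- Linkages in the two halves of a prism combine to one of the prism, if each colour `i` that
is used in both halves comes with a place `u i` where to change sides. -/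
theorem links_prism {G : SimpleGraph V} {f : Bool × V → Option κ} {R RA M : Set κ}
    {s t u : κ → V} {gA gB : V → Option κ}
    (hM : ∀ i ∈ R, ∀ v w, f (true, v) = some i → f (false, w) = some i →
      i ∈ M ∧ v = s i ∧ w = t i)
    (hs : ∀ i ∈ M, f (true, s i) = some i) (ht : ∀ i ∈ M, f (false, t i) = some i)
    (hgA : ∀ v i, f (true, v) = some i → gA v = some i) (huA : ∀ i ∈ M, gA (u i) = some i)
    (hgB : ∀ v i, f (false, v) = some i → gB v = some i) (huB : ∀ i ∈ M, gB (u i) = some i)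
    (hRA : ∀ i ∈ R, i ∉ RA → i ∈ M ∧ (u i = s i ∨ G.Adj (s i) (u i)))
    (hA : Links G gA RA) (hB : Links G gB R) : Links (prism G) f R := by
  obtain ⟨cA, hcA, hlA⟩ := hA
  obtain ⟨cB, hcB, hlB⟩ := hB
  set c : Bool × V → Option κ := fun x => bif x.1 then cA x.2 else cB x.2 with hc
  have cross : ∀ i ∈ R, i ∈ M →
      JoinedWithin (prism G) {x | c x = some i} (true, s i) (false, t i) := by
    intro i hiR hi
    have h1 : JoinedWithin G {x | cA x = some i} (s i) (u i) := by
      by_cases hiA : i ∈ RA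
      · exact hlA i hiA _ _ (hgA _ _ (hs i hi)) (huA i hi)
      · rcases (hRA i hiR hiA).2 with h | h
        · rw [h]
          exact .refl (hcA _ _ (hgA _ _ (hs i hi)))
        · exact .of_adj h (hcA _ _ (hgA _ _ (hs i hi))) (hcA _ _ (huA i hi))
    refine (h1.prism true (T := {x | c x = some i}) (by simp [hc])).trans
      ((JoinedWithin.rung ?_ true false).trans
      ((hlB i hiR _ _ (huB i hi) (hgB _ _ (ht i hi))).prism false (by simp [hc])))
    rintro (_ | _)
    · exact hcB _ _ (huB i hi)
    · exact hcA _ _ (huA i hi)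
  refine ⟨c, ?_, ?_⟩
  · rintro ⟨_ | _, v⟩ i hv
    · exact hcB _ _ (hgB _ _ hv)
    · exact hcA _ _ (hgA _ _ hv)
  · rintro i hi ⟨_ | _, v⟩ ⟨_ | _, w⟩ hv hw
    · exact (hlB i hi v w (hgB _ _ hv) (hgB _ _ hw)).prism false (by simp [hc])
    · obtain ⟨h, rfl, rfl⟩ := hM i hi w v hw hv
      exact (cross i hi h).symm
    · obtain ⟨h, rfl, rfl⟩ := hM i hi v w hv hw
      exact cross i hi h
    · by_cases hiA : i ∈ RA
      · exact (hlA i hiA v w (hgA _ _ hv) (hgA _ _ hw)).prism true (by simp [hc])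
      -- A colour not linked above belongs to a divided pair, so both upper vertices are the single
      -- one `s i`.
      · have h := ht i (hRA i hi hiA).1
        rw [(hM i hi v _ hv h).2.1, (hM i hi w _ hw h).2.1]
        exact .refl (hcA _ _ (hgA _ _ (hs i (hRA i hi hiA).1)))

/-- The partial colouring `h`, with the uncoloured vertices among the `u i` for `i ∈ M` given
colour `i`. -/
noncomputable def extendColouring (h : V → Option κ) (M : Finset κ) (u : κ → V) (v : V) :
    Option κ :=
  if h v ≠ none then h v else if hv : ∃ i ∈ M, u i = v then some hv.choose else none

section extendColouring

variable {h : V → Option κ} {M : Finset κ} {u : κ → V}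

theorem extendColouring_of_eq_some {v : V} {i : κ} (hv : h v = some i) :
    extendColouring h M u v = some i := by
  simp [extendColouring, hv]

theorem extendColouring_apply (hu : Set.InjOn u M) {i : κ} (hi : i ∈ M)
    (hui : h (u i) = none ∨ h (u i) = some i) : extendColouring h M u (u i) = some i := by
  rcases hui with hui | hui
  · have hex : ∃ j ∈ M, u j = u i := ⟨i, hi, rfl⟩
    simp only [extendColouring, hui, ne_eq, not_true_eq_false, if_false, dif_pos hex]
    exact congrArg some (hu hex.choose_spec.1 hi hex.choose_spec.2)
  · exact extendColouring_of_eq_some hui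

theorem eq_some_of_extendColouring {v : V} {i : κ} (hv : extendColouring h M u v = some i) :
    h v = some i ∨ i ∈ M ∧ v = u i := by
  unfold extendColouring at hv
  split_ifs at hv with h1 h2
  · exact .inl hv
  · right
    obtain rfl := Option.some.inj hv
    exact ⟨h2.choose_spec.1, h2.choose_spec.2.symm⟩

/-- Only places of colours in `N` can be newly coloured. Taking `N` smaller than `M` gains the one
vertex needed when some place is already an end of its pair. -/
theorem card_coloured_extendColouring_le [Fintype V] (N : Finset κ)
    (hN : ∀ i ∈ M, i ∉ N → h (u i) ≠ none) :
    (coloured (extendColouring h M u)).card ≤ (coloured h).card + N.card := by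
  have : coloured (extendColouring h M u) ⊆ coloured h ∪ N.image u := by
    intro v hv
    rw [mem_coloured, Option.ne_none_iff_exists'] at hv
    obtain ⟨i, hi⟩ := hv
    rw [Finset.mem_union, mem_coloured, Finset.mem_image]
    rcases eq_some_of_extendColouring hi with h1 | ⟨hiM, rfl⟩
    · simp [h1]
    · by_cases hiN : i ∈ N
      · exact .inr ⟨i, hiN, rfl⟩
      · exact .inl (hN i hiM hiN)
  exact (Finset.card_le_card this).trans ((Finset.card_union_le _ _).trans
    (Nat.add_le_add_left Finset.card_image_le _))

/-- A divided pair has one end `s i` in the half considered, so its place `u i` is at most a second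
vertex of that colour. -/
theorem AtMostPairs.extendColouring {R : Set κ} (hp : AtMostPairs h R) {s : κ → V}
    (hs : ∀ i ∈ M, ∀ v, h v = some i → v = s i) :
    AtMostPairs (extendColouring h M u) R := by
  intro i hi x y z hx hy hz
  by_cases hiM : i ∈ M
  · have key : ∀ v, CubeLinkage.extendColouring h M u v = some i → v = s i ∨ v = u i := by
      intro v hv
      rcases eq_some_of_extendColouring hv with h1 | h1
      exacts [.inl (hs i hiM v h1), .inr h1.2]
    rcases key x hx with rfl | rfl <;> rcases key y hy with rfl | rfl <;>
      rcases key z hz with rfl | rfl <;> simp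
  · have key : ∀ v, CubeLinkage.extendColouring h M u v = some i → h v = some i := by
      intro v hv
      rcases eq_some_of_extendColouring hv with h1 | h1
      exacts [h1, absurd h1.1 hiM]
    exact hp i hi x y z (key x hx) (key y hy) (key z hz)

end extendColouring

end Linkages

end CubeLinkage

namespace CubeLinkage

/-! ### The inductive step from a graph to its prism. -/

section PrismStep

open scoped Classical

variable {V κ : Type*}

theorem card_coloured_prism [Fintype V] (f : Bool × V → Option κ) :
    (coloured fun v => f (true, v)).card + (coloured fun v => f (false, v)).card =
      (coloured f).card := by
  simp only [coloured, Finset.card_filter, Fintype.sum_prod_type, Fintype.sum_bool]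

/-- Places for changing sides, given on `N ⊆ M`, extend to `M` by uncoloured vertices. -/
theorem exists_injOn_extension [Fintype V] {M N : Finset κ} (hNM : N ⊆ M) {u₀ : κ → V}
    (h₀ : Set.InjOn u₀ N) (P : Finset V) (h : N = M ∨ P.card + M.card ≤ Fintype.card V) :
    ∃ u : κ → V, Set.InjOn u M ∧ (∀ i ∈ N, u i = u₀ i) ∧ ∀ i ∈ M, i ∉ N → u i ∉ P := by
  rcases h with rfl | h
  · exact ⟨u₀, h₀, fun _ _ => rfl, fun i hi hi' => absurd hi hi'⟩
  set F : Finset V := P ∪ N.image u₀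
  have hF : F.card ≤ P.card + N.card :=
    (Finset.card_union_le _ _).trans (Nat.add_le_add_left Finset.card_image_le _)
  have hc : Fintype.card ↥(M \ N) ≤ Fintype.card ↥(Fᶜ) := by
    have h1 := Finset.card_sdiff_add_card_eq_card hNM
    have h2 := Finset.card_add_card_compl F
    rw [Fintype.card_coe, Fintype.card_coe]
    omega
  obtain ⟨e⟩ := Function.Embedding.nonempty_of_card_le hc
  have he : ∀ i (hi : i ∈ M \ N), (e ⟨i, hi⟩ : V) ∉ P ∧ ∀ j ∈ N, u₀ j ≠ (e ⟨i, hi⟩ : V) := by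
    intro i hi
    have := (e ⟨i, hi⟩).2
    simp only [F, Finset.mem_compl, Finset.mem_union, Finset.mem_image, not_or, not_exists,
      not_and] at this
    exact this
  refine ⟨fun i => if hi : i ∈ M \ N then e ⟨i, hi⟩ else u₀ i, ?_, ?_, ?_⟩
  · intro i hi j hj hij
    by_cases hiN : i ∈ N <;> by_cases hjN : j ∈ N
    · simp only [Finset.mem_sdiff, hiN, hjN, not_true_eq_false, and_false, dite_false] at hij
      exact h₀ hiN hjN hij
    · have hj' : j ∈ M \ N := Finset.mem_sdiff.2 ⟨hj, hjN⟩
      have hi' : i ∉ M \ N := fun h => (Finset.mem_sdiff.1 h).2 hiN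
      simp only [hi', hj', dite_true, dite_false] at hij
      exact absurd hij ((he j hj').2 i hiN)
    · have hi' : i ∈ M \ N := Finset.mem_sdiff.2 ⟨hi, hiN⟩
      have hj' : j ∉ M \ N := fun h => (Finset.mem_sdiff.1 h).2 hjN
      simp only [hi', hj', dite_true, dite_false] at hij
      exact absurd hij.symm ((he i hi').2 j hjN)
    · have hi' : i ∈ M \ N := Finset.mem_sdiff.2 ⟨hi, hiN⟩
      have hj' : j ∈ M \ N := Finset.mem_sdiff.2 ⟨hj, hjN⟩
      simp only [hi', hj', dite_true] at hij
      simpa using e.injective (Subtype.ext hij)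
  · intro i hi
    simp [hi]
  · intro i hi hiN
    have hi' : i ∈ M \ N := Finset.mem_sdiff.2 ⟨hi, hiN⟩
    simp only [hi', dite_true]
    exact (he i hi').1

/-- A vertex `s` of colour `i` in the upper half can reach the lower half, directly or through
a neighbour, at a place that is free or of colour `i`. -/
theorem exists_crossing_near [Fintype V] {G : SimpleGraph V} {n : ℕ}
    (hdeg : ∀ v, n ≤ (Finset.univ.filter (G.Adj v)).card + 1) {f : Bool × V → Option κ}
    (hf : (coloured f).card ≤ n + 1) {i : κ} {s t : V} (hs : f (true, s) = some i)
    (ht : f (false, t) = some i) :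
    ∃ u, (u = s ∨ G.Adj s u) ∧ (f (true, u) = none ∨ f (true, u) = some i) ∧
      (f (false, u) = none ∨ f (false, u) = some i) := by
  by_cases h0 : f (false, s) = none ∨ f (false, s) = some i
  · exact ⟨s, .inl rfl, .inr hs, h0⟩
  rw [not_or] at h0
  have hst : s ≠ t := by rintro rfl; exact h0.2 ht
  set A := coloured fun v => f (true, v)
  set B := coloured fun v => f (false, v)
  have hsA : s ∈ A := mem_coloured.2 (by simp [hs])
  have htB : t ∈ B := mem_coloured.2 (by simp [ht])
  have hsB : s ∈ B.erase t := Finset.mem_erase.2 ⟨hst, mem_coloured.2 h0.1⟩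
  -- A neighbour of `s` is bad only if it is coloured above, or coloured below and different from
  -- `t`. Discarding `s` above and `s`, `t` below leaves at most `n - 2` bad ones, against at least
  -- `n - 1` neighbours.
  have hlt : (A.erase s ∪ (B.erase t).erase s).card < (Finset.univ.filter (G.Adj s)).card := by
    have h1 := Finset.card_union_le (A.erase s) ((B.erase t).erase s)
    have h2 := Finset.card_erase_add_one hsA
    have h3 := Finset.card_erase_add_one htB
    have h4 := Finset.card_erase_add_one hsB
    have h5 : A.card + B.card = (coloured f).card := card_coloured_prism f
    have h6 := hdeg s
    omega
  obtain ⟨u, hu, hu'⟩ := Finset.exists_mem_notMem_of_card_lt_card hlt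
  have hadj : G.Adj s u := (Finset.mem_filter.1 hu).2
  simp only [Finset.mem_union, Finset.mem_erase, A, B, mem_coloured, not_or, not_and, not_not] at hu'
  refine ⟨u, .inr hadj, .inl (hu'.1 hadj.ne'), ?_⟩
  by_cases hut : u = t
  · exact .inr (hut ▸ ht)
  · exact .inl (hu'.2 hadj.ne' hut)

/-- If all but one of the coloured vertices lie in one half of a prism, and the other one need
not be linked, then a pair can be linked through the other half. -/
theorem links_prism_of_forall_eq [Fintype V] {G : SimpleGraph V} {n : ℕ}
    (hG : Linkable κ G n) (hconn : G.Preconnected)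
    {f : Bool × V → Option κ} {R : Set κ} (hp : AtMostPairs f R)
    (hA : (coloured fun v => f (true, v)).card = n)
    {o : V} {j : κ} (ho : f (false, o) = some j) (hj : j ∉ R)
    (hB : ∀ v, f (false, v) ≠ none → v = o) : Links (prism G) f R := by
  have hpA : AtMostPairs (fun v => f (true, v)) R := by
    intro i hi x y z hx hy hz
    simpa using hp i hi _ _ _ hx hy hz
  rcases le_or_gt n 2 with hn | hn
  · refine links_prism (s := fun _ => o) (t := fun _ => o) (u := fun _ => o) (M := ∅) (RA := R)
      (gA := fun v => f (true, v)) (gB := fun v => f (false, v)) ?_ (by simp) (by simp)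
      (fun _ _ h => h) (by simp) (fun _ _ h => h) (by simp) (fun i h h' => absurd h h')
      (links_of_card_le_two hconn (hA.trans_le hn)) (links_of_subsingleton ?_)
    · intro i hi v w _ hw
      rw [hB w (by simp [hw]), ho] at hw
      exact absurd (Option.some.inj hw ▸ hi) hj
    · intro i _ v w hv hw
      rw [hB v (by simp [hv]), hB w (by simp [hw])]
  by_cases hall : ∀ v i, f (true, v) = some i → i ∈ R
  swap
  · push Not at hall
    obtain ⟨v, i, hv, hi⟩ := hall
    refine links_prism (s := fun _ => o) (t := fun _ => o) (u := fun _ => o) (M := ∅) (RA := R)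
      (gA := fun v => f (true, v)) (gB := fun v => f (false, v)) ?_ (by simp) (by simp)
      (fun _ _ h => h) (by simp) (fun _ _ h => h) (by simp) (fun i h h' => absurd h h')
      (hG _ _ hA.le hpA ⟨v, i, hi, hv⟩) (links_of_subsingleton ?_)
    · intro i hi v w _ hw
      rw [hB w (by simp [hw]), ho] at hw
      exact absurd (Option.some.inj hw ▸ hi) hj
    · intro i _ v w hv hw
      rw [hB v (by simp [hv]), hB w (by simp [hw])]
  have hcl : ∀ i ∈ R, ((coloured fun v => f (true, v)).filter
      fun v => f (true, v) = some i).card ≤ 2 := by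
    intro i hi
    by_contra! h
    obtain ⟨x, y, z, hx, hy, hz, hxy, hxz, hyz⟩ := Finset.two_lt_card_iff.1 h
    rcases hpA i hi x y z (Finset.mem_filter.1 hx).2 (Finset.mem_filter.1 hy).2
      (Finset.mem_filter.1 hz).2 with h | h | h <;> contradiction
  -- The colour to be rerouted must not occur directly above `o`, so that its projections avoid `o`.
  -- If no such colour existed, all coloured vertices above would share one colour of `R`, hence
  -- number at most two, against `2 < n`.
  obtain ⟨v, i, hv, hvo⟩ : ∃ v i, f (true, v) = some i ∧ f (true, o) ≠ some i := by
    have hpos : 0 < (coloured fun v => f (true, v)).card := by omega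
    by_contra! h
    obtain ⟨v, hv⟩ := Finset.card_pos.1 hpos
    obtain ⟨i, hi⟩ := Option.ne_none_iff_exists'.1 (mem_coloured.1 hv)
    have h1 := hcl i (hall v i hi)
    rw [Finset.filter_true_of_mem] at h1
    · omega
    · intro w hw
      obtain ⟨k, hk⟩ := Option.ne_none_iff_exists'.1 (mem_coloured.1 hw)
      have := h w k hk
      rw [h v i hi] at this
      rw [hk, this]
  have hi := hall v i hv
  -- Colour `i` is linked below, so above it serves as the obstacle.
  obtain ⟨cA, hcA, hlA⟩ := hG (fun v => f (true, v)) (R \ {i}) hA.le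
    (fun k hk => hpA k hk.1) ⟨v, i, by simp, hv⟩
  set gB : V → Option κ := fun w =>
    if w = o then some j else if f (true, w) = some i then some i else none
  have hgB : ∀ w, f (true, w) = some i → gB w = some i := by
    intro w hw
    have : w ≠ o := by rintro rfl; exact hvo hw
    simp [gB, this, hw]
  have hgB' : ∀ w k, k ∈ R → gB w = some k → k = i ∧ f (true, w) = some i := by
    intro w k hk hw
    simp only [gB] at hw
    split_ifs at hw with h1 h2
    · exact absurd (Option.some.inj hw ▸ hk) hj
    · exact ⟨(Option.some.inj hw).symm, h2⟩
  -- The lower half carries `o` and at most two projections: three vertices, which is allowed since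
  -- `2 < n`.
  obtain ⟨cB, hcB, hlB⟩ := hG gB R (by
      have : coloured gB ⊆ insert o ((coloured fun v => f (true, v)).filter
          fun v => f (true, v) = some i) := by
        intro w hw
        simp only [mem_coloured, gB] at hw
        simp only [Finset.mem_insert, Finset.mem_filter, mem_coloured]
        by_cases hwo : w = o
        · exact .inl hwo
        · right
          by_cases hwi : f (true, w) = some i
          · simp [hwi]
          · simp [hwo, hwi] at hw
      have h1 := Finset.card_le_card this
      have h2 := Finset.card_insert_le o ((coloured fun v => f (true, v)).filter
          fun v => f (true, v) = some i)
      have h3 := hcl i hi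
      omega)
    (fun k hk x y z hx hy hz => by
      obtain ⟨rfl, hx⟩ := hgB' x k hk hx
      exact hpA k hk x y z hx (hgB' y k hk hy).2 (hgB' z k hk hz).2)
    ⟨o, j, hj, by simp [gB]⟩
  set c : Bool × V → Option κ := fun x => bif x.1 then cA x.2 else cB x.2 with hc
  have hB' : ∀ k ∈ R, ∀ w, f (false, w) ≠ some k := by
    intro k hk w hw
    rw [hB w (by simp [hw]), ho] at hw
    exact hj (Option.some.inj hw ▸ hk)
  refine ⟨c, ?_, ?_⟩
  · rintro ⟨_ | _, w⟩ k hw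
    · refine hcB _ _ ?_
      have : w = o := hB w (by simp [hw])
      subst this
      simp only [gB, if_true]
      rw [← ho, hw]
    · exact hcA _ _ hw
  · rintro k hk ⟨_ | _, y⟩ ⟨_ | _, z⟩ hy hz
    · exact absurd hy (hB' k hk y)
    · exact absurd hy (hB' k hk y)
    · exact absurd hz (hB' k hk z)
    · by_cases hki : k = i
      · subst hki
        have rung : ∀ w, f (true, w) = some k →
            JoinedWithin (prism G) {x | c x = some k} (true, w) (false, w) := by
          intro w hw
          refine JoinedWithin.rung ?_ _ _
          rintro (_ | _)
          · exact hcB _ _ (hgB w hw)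
          · exact hcA _ _ hw
        exact (rung y hy).trans (((hlB k hk y z (hgB y hy) (hgB z hz)).prism false
          (by simp [hc])).trans (rung z hz).symm)
      · exact (hlA k ⟨hk, hki⟩ y z hy hz).prism true (by simp [hc])

/-- The inductive step: if `G` is linkable for `n` vertices, then its prism is for `n + 1`. -/
theorem links_prism_of_linkable [Fintype V] [Fintype κ] {G : SimpleGraph V} {n : ℕ}
    (hG : Linkable κ G n) (hconn : G.Preconnected)
    (hdeg : ∀ v, n ≤ (Finset.univ.filter (G.Adj v)).card + 1)
    (hV : n ≤ Fintype.card V) (hV' : 4 ≤ n → 2 * n ≤ Fintype.card V)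
    {f : Bool × V → Option κ} {R : Set κ} (hf : (coloured f).card ≤ n + 1) (hp : AtMostPairs f R)
    {o : V} {j : κ} (ho : f (false, o) = some j) (hj : j ∉ R)
    {x : V} (hx : f (true, x) ≠ none) (hx' : f (false, x) = none ∨ x = o) :
    Links (prism G) f R := by
  have hpA : AtMostPairs (fun v => f (true, v)) R := by
    intro i hi x y z hx hy hz
    simpa using hp i hi _ _ _ hx hy hz
  have hpB : AtMostPairs (fun v => f (false, v)) R := by
    intro i hi x y z hx hy hz
    simpa using hp i hi _ _ _ hx hy hz
  have hab := card_coloured_prism f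
  set A := coloured fun v => f (true, v) with hA
  set B := coloured fun v => f (false, v) with hB
  have hxA : x ∈ A := mem_coloured.2 hx
  have hoB : o ∈ B := mem_coloured.2 (by simp [ho])
  have ha : 1 ≤ A.card := Finset.card_pos.2 ⟨x, hxA⟩
  have hb : 1 ≤ B.card := Finset.card_pos.2 ⟨o, hoB⟩
  set M : Finset κ := Finset.univ.filter fun i =>
    i ∈ R ∧ (∃ v, f (true, v) = some i) ∧ ∃ w, f (false, w) = some i with hMdef
  obtain ⟨s, hs⟩ : ∃ s : κ → V, ∀ i ∈ M, f (true, s i) = some i := by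
    have : ∀ i, ∃ v, i ∈ M → f (true, v) = some i := by
      intro i
      by_cases hi : i ∈ M
      · obtain ⟨v, hv⟩ := (Finset.mem_filter.1 hi).2.2.1
        exact ⟨v, fun _ => hv⟩
      · exact ⟨o, fun h => absurd h hi⟩
    choose s hs using this
    exact ⟨s, hs⟩
  obtain ⟨t, ht⟩ : ∃ t : κ → V, ∀ i ∈ M, f (false, t i) = some i := by
    have : ∀ i, ∃ v, i ∈ M → f (false, v) = some i := by
      intro i
      by_cases hi : i ∈ M
      · obtain ⟨v, hv⟩ := (Finset.mem_filter.1 hi).2.2.2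
        exact ⟨v, fun _ => hv⟩
      · exact ⟨o, fun h => absurd h hi⟩
    choose t ht using this
    exact ⟨t, ht⟩
  have hMR : ∀ i ∈ M, i ∈ R := fun i hi => (Finset.mem_filter.1 hi).2.1
  have hs' : ∀ i ∈ M, ∀ v, f (true, v) = some i → v = s i := by
    intro i hi v hv
    simpa using hp i (hMR i hi) _ _ _ hv (hs i hi) (ht i hi)
  have ht' : ∀ i ∈ M, ∀ v, f (false, v) = some i → v = t i := by
    intro i hi v hv
    simpa using hp i (hMR i hi) _ _ _ hv (ht i hi) (hs i hi)
  have hM : ∀ i ∈ R, ∀ v w, f (true, v) = some i → f (false, w) = some i →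
      i ∈ (M : Set κ) ∧ v = s i ∧ w = t i := by
    intro i hi v w hv hw
    have hiM : i ∈ M := Finset.mem_filter.2 ⟨Finset.mem_univ i, hi, ⟨v, hv⟩, ⟨w, hw⟩⟩
    exact ⟨hiM, hs' i hiM v hv, ht' i hiM w hw⟩
  have htinj : Set.InjOn t M := by
    intro i hi k hk hik
    have := ht i hi
    rw [hik, ht k hk] at this
    exact (Option.some.inj this).symm
  have hsinj : Set.InjOn s M := by
    intro i hi k hk hik
    have := hs i hi
    rw [hik, hs k hk] at this
    exact (Option.some.inj this).symm
  have hMa : M.card ≤ A.card := Finset.card_le_card_of_injOn s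
    (fun i hi => mem_coloured.2 (by simp [hs i hi])) hsinj
  -- The extra one is `o`, whose colour lies outside `R`.
  have hMb : M.card + 1 ≤ B.card := by
    rw [← Finset.card_erase_add_one hoB]
    refine Nat.add_le_add_right (Finset.card_le_card_of_injOn t (fun i hi => ?_) htinj) 1
    refine Finset.mem_erase.2 ⟨fun h => hj ?_, mem_coloured.2 (by simp [ht i hi])⟩
    have := ht i hi
    rw [h, ho] at this
    exact Option.some.inj this ▸ hMR i hi
  -- linking through places `u i` for changing sides
  have main : ∀ (u : κ → V) (RA : Set κ) (_ : Set.InjOn u M)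
      (_ : ∀ i ∈ M, f (true, u i) = none ∨ f (true, u i) = some i)
      (_ : ∀ i ∈ M, f (false, u i) = none ∨ f (false, u i) = some i)
      (_ : ∀ i ∈ R, i ∉ RA → i ∈ M ∧ (u i = s i ∨ G.Adj (s i) (u i)))
      (_ : Links G (extendColouring (fun v => f (true, v)) M u) RA)
      (_ : ∃ N ⊆ M, B.card + N.card ≤ n ∧ ∀ i ∈ M, i ∉ N → f (false, u i) ≠ none),
      Links (prism G) f R := by
    intro u RA hu huA huB hRA hLA ⟨N, _, hN, hN'⟩
    refine links_prism (M := (M : Set κ)) (gA := extendColouring (fun v => f (true, v)) M u)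
      (gB := extendColouring (fun v => f (false, v)) M u) hM hs ht (fun _ _ hv => extendColouring_of_eq_some hv)
      (fun i hi => extendColouring_apply hu hi (huA i hi))
      (fun _ _ hv => extendColouring_of_eq_some hv)
      (fun i hi => extendColouring_apply hu hi (huB i hi)) hRA hLA
      (hG _ _ ?_ ?_ ⟨o, j, hj, extendColouring_of_eq_some ho⟩)
    · exact (card_coloured_extendColouring_le (h := fun v => f (false, v)) N hN').trans hN
    · exact hpB.extendColouring ht'
  have hext : ∀ (u₀ : κ → V) (N : Finset κ), N ⊆ M → Set.InjOn u₀ N → 1 ≤ N.card →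
      ∃ u : κ → V, Set.InjOn u M ∧ (∀ i ∈ N, u i = u₀ i) ∧
        ∀ i ∈ M, i ∉ N → f (true, u i) = none ∧ f (false, u i) = none := by
    intro u₀ N hNM hN h1
    -- If places are still missing, `M` has at least two colours, so there are at least two coloured
    -- vertices above and three below. This forces `4 ≤ n`, and `2 * n` columns leave enough free
    -- ones.
    obtain ⟨u, hu, huN, huM⟩ := exists_injOn_extension hNM hN (A ∪ B) (by
      by_cases hNM' : N = M
      · exact .inl hNM'
      · right
        have h2 := Finset.card_lt_card (Finset.ssubset_iff_subset_ne.2 ⟨hNM, hNM'⟩)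
        have h3 := Finset.card_union_le A B
        have := hV' (by omega)
        omega)
    refine ⟨u, hu, huN, fun i hi hiN => ?_⟩
    simpa [A, B, mem_coloured, not_or] using huM i hi hiN
  rcases hMa.lt_or_eq with hlt | heq
  · rcases Finset.eq_empty_or_nonempty M with hM0 | ⟨i, hi⟩
    · have hMe : ∀ i, i ∉ M := by simp [hM0]
      have hAB : Links G (fun v => f (true, v)) R → Links (prism G) f R := fun h =>
        links_prism (M := (M : Set κ)) (u := s) hM hs ht (fun _ _ h => h)
          (fun i hi => absurd hi (hMe i)) (fun _ _ h => h) (fun i hi => absurd hi (hMe i))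
          (fun i h h' => absurd h h') h
          (hG _ _ (by rw [← hB]; omega) hpB ⟨o, j, hj, ho⟩)
      by_cases hAn : A.card < n
      · exact hAB (hG.links_of_card_lt hAn (hAn.trans_le hV) hpA ⟨j, hj⟩)
      -- Now `o` is the only coloured vertex below.
      · refine links_prism_of_forall_eq hG hconn hp (by rw [← hA]; omega) ho hj fun v hv => ?_
        have hB1 : B.card ≤ 1 := by omega
        exact Finset.card_le_one.1 hB1 v (mem_coloured.2 hv) o hoB
    -- Pair `i` crosses next to `s i`, which becomes the upper obstacle. Both halves stay within `n`
    -- coloured vertices because `M.card < A.card` and `M.card < B.card`.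
    · obtain ⟨w, hw, hwA, hwB⟩ := exists_crossing_near hdeg hf (hs i hi) (ht i hi)
      obtain ⟨u, hu, huN, huM⟩ := hext (fun _ => w) {i} (by simpa using hi) (by simp) (by simp)
      have hui : u i = w := huN i (by simp)
      refine main u (R \ {i}) hu ?_ ?_ ?_ (hG _ _ ?_ ?_ ⟨s i, i, by simp, ?_⟩)
        ⟨M, subset_rfl, by omega, fun i hi hi' => absurd hi hi'⟩
      · intro k hk
        by_cases hki : k = i
        · subst hki; rwa [hui]
        · exact .inl (huM k hk (by simpa using hki)).1
      · intro k hk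
        by_cases hki : k = i
        · subst hki; rwa [hui]
        · exact .inl (huM k hk (by simpa using hki)).2
      · intro k hk hk'
        obtain rfl : k = i := by simpa [hk] using hk'
        rw [hui]
        exact ⟨hi, hw⟩
      · have h1 := card_coloured_extendColouring_le (h := fun v => f (true, v)) (M := M) (u := u) M
          (fun i hi hi' => absurd hi hi')
        rw [← hA] at h1
        omega
      · exact AtMostPairs.extendColouring (fun k hk => hpA k hk.1) hs'
      · exact extendColouring_of_eq_some (hs i hi)
  -- The lower half may now exceed `n` by one, which is avoided by letting a pair cross at its lower
  -- end `t i`. This requires the vertex above `t i` to be free. If all of these were coloured, they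
  -- would be exactly the coloured vertices above, and `x` would lie above some `t i`, contrary to
  -- its choice.
  · obtain ⟨i, hi, hiA⟩ : ∃ i ∈ M, f (true, t i) = none := by
      by_contra! h
      have himg : M.image t = A := by
        refine Finset.eq_of_subset_of_card_le ?_ ?_
        · intro v hv
          obtain ⟨i, hi, rfl⟩ := Finset.mem_image.1 hv
          exact mem_coloured.2 (h i hi)
        · rw [Finset.card_image_of_injOn htinj]
          omega
      obtain ⟨i, hi, rfl⟩ := Finset.mem_image.1 (himg ▸ hxA)
      have hti := ht i hi
      rcases hx' with h1 | h1
      · simp [h1] at hti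
      · rw [h1, ho] at hti
        exact hj (Option.some.inj hti ▸ hMR i hi)
    -- With a single divided pair, only its end and its place are coloured above, and connectedness
    -- suffices; otherwise a second pair `k` provides the upper obstacle.
    by_cases hm : M = {i}
    · refine main t R htinj ?_ (fun k hk => .inr (ht k hk)) (fun k hk hk' => absurd hk hk')
        (links_of_card_le_two hconn ?_) ⟨∅, by simp, by simp; omega, fun k hk _ => by simp [ht k hk]⟩
      · intro k hk
        obtain rfl : k = i := by simpa [hm] using hk
        exact .inl hiA
      · have h1 := card_coloured_extendColouring_le (h := fun v => f (true, v)) (M := M) (u := t) M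
          (fun i hi hi' => absurd hi hi')
        have h2 : M.card = 1 := by simp [hm]
        rw [← hA] at h1
        omega
    · obtain ⟨k, hk, hki⟩ : ∃ k ∈ M, k ≠ i := by
        by_contra! h
        exact hm (Finset.eq_singleton_iff_unique_mem.2 ⟨hi, h⟩)
      obtain ⟨w, hw, hwA, hwB⟩ := exists_crossing_near hdeg hf (hs k hk) (ht k hk)
      have hwt : w ≠ t i := by
        rintro rfl
        rw [ht i hi] at hwB
        simp [hki.symm] at hwB
      obtain ⟨u, hu, huN, huM⟩ := hext (fun l => if l = i then t i else w) {i, k}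
        (by simp [Finset.insert_subset_iff, hi, hk])
        (by
          intro a ha b hb hab
          simp only [Finset.coe_insert, Finset.coe_singleton, Set.mem_insert_iff,
            Set.mem_singleton_iff] at ha hb
          rcases ha with ha | ha <;> rcases hb with hb | hb
          · rw [ha, hb]
          · simp only [ha, hb, hki, if_true, if_false] at hab
            exact absurd hab.symm hwt
          · simp only [ha, hb, hki, if_true, if_false] at hab
            exact absurd hab hwt
          · rw [ha, hb])
        (Finset.card_pos.2 ⟨i, by simp⟩)
      have hui : u i = t i := by rw [huN i (by simp)]; simp
      have huk : u k = w := by rw [huN k (by simp)]; simp [hki]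
      refine main u (R \ {k}) hu ?_ ?_ ?_ (hG _ _ ?_ ?_ ⟨s k, k, by simp, ?_⟩)
        ⟨M.erase i, Finset.erase_subset _ _, ?_, ?_⟩
      · intro l hl
        by_cases hli : l = i
        · subst hli; rw [hui]; exact .inl hiA
        by_cases hlk : l = k
        · subst hlk; rwa [huk]
        · exact .inl (huM l hl (by simp [hli, hlk])).1
      · intro l hl
        by_cases hli : l = i
        · subst hli; rw [hui]; exact .inr (ht l hl)
        by_cases hlk : l = k
        · subst hlk; rwa [huk]
        · exact .inl (huM l hl (by simp [hli, hlk])).2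
      · intro l hl hl'
        obtain rfl : l = k := by simpa [hl] using hl'
        rw [huk]
        exact ⟨hk, hw⟩
      · have h1 := card_coloured_extendColouring_le (h := fun v => f (true, v)) (M := M) (u := u) M
          (fun i hi hi' => absurd hi hi')
        rw [← hA] at h1
        omega
      · exact AtMostPairs.extendColouring (fun l hl => hpA l hl.1) hs'
      · exact extendColouring_of_eq_some (hs k hk)
      · have := Finset.card_erase_add_one hi
        omega
      · intro l hl hl'
        obtain rfl : l = i := by simpa [hl] using hl'
        rw [hui, ht l hl]
        simp

end PrismStep

end CubeLinkage

namespace CubeLinkage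

/-! ### Linkability of the cube graph. -/

section CubeGraph

open scoped Classical

variable {d : ℕ}

/-- The graph of the cube `{0, 1}ᵈ`. -/
def cubeGraph (d : ℕ) : SimpleGraph (Fin d → Bool) where
  Adj x y := ∃ e, x e ≠ y e ∧ ∀ i, i ≠ e → x i = y i
  symm := ⟨fun _ _ ⟨e, h, h'⟩ => ⟨e, h.symm, fun i hi => (h' i hi).symm⟩⟩
  loopless := ⟨fun _ ⟨_, h, _⟩ => h rfl⟩

theorem cubeGraph_adj_update {x : Fin d → Bool} {e : Fin d} {b : Bool} (h : x e ≠ b) :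
    (cubeGraph d).Adj x (Function.update x e b) :=
  ⟨e, by simpa using h, fun i hi => by simp [hi]⟩

theorem hammingDist_update_lt {x y : Fin d → Bool} {e : Fin d} (h : x e ≠ y e) :
    hammingDist (Function.update x e (y e)) y < hammingDist x y := by
  refine Finset.card_lt_card (Finset.ssubset_iff_of_subset ?_ |>.2 ⟨e, by simpa using h, by simp⟩)
  intro i hi
  by_cases hie : i = e <;> simp_all

theorem cubeGraph_preconnected (d : ℕ) : (cubeGraph d).Preconnected := by
  suffices ∀ n, ∀ x y : Fin d → Bool, hammingDist x y = n → (cubeGraph d).Reachable x y from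
    fun x y => this _ x y rfl
  intro n
  induction n using Nat.strong_induction_on with
  | _ n ih =>
    intro x y hn
    by_cases hxy : x = y
    · rw [hxy]
    · obtain ⟨e, he⟩ := Function.ne_iff.1 hxy
      exact (cubeGraph_adj_update he).reachable.trans
        (ih _ (hn ▸ hammingDist_update_lt he) _ _ rfl)

theorem le_card_neighbors_cubeGraph (x : Fin d → Bool) :
    d ≤ (Finset.univ.filter ((cubeGraph d).Adj x)).card := by
  have : (Finset.univ.image fun e => Function.update x e (!x e)).card = d := by
    rw [Finset.card_image_of_injective, Finset.card_univ, Fintype.card_fin]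
    intro e e' h
    by_contra hne
    have := congrFun h e
    simp [hne] at this
  refine this.ge.trans (Finset.card_le_card fun y hy => ?_)
  obtain ⟨e, -, rfl⟩ := Finset.mem_image.1 hy
  exact Finset.mem_filter.2 ⟨Finset.mem_univ _, cubeGraph_adj_update (by simp)⟩

/-- The cube as a prism in direction `e`, with the lower half given by the value `b`. -/
def prismEquivCube (e : Fin (d + 1)) (b : Bool) :
    Bool × (Fin d → Bool) ≃ (Fin (d + 1) → Bool) :=
  ((Function.Involutive.toPerm (fun a => xor a b) fun a => by simp).prodCongr
    (Equiv.refl _)).trans (Fin.insertNthEquiv (fun _ => Bool) e)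

theorem prismEquivCube_apply (e : Fin (d + 1)) (b a : Bool) (v : Fin d → Bool) :
    prismEquivCube e b (a, v) = Fin.insertNth (α := fun _ => Bool) e (xor a b) v := rfl

theorem prismEquivCube_adj (e : Fin (d + 1)) (b : Bool) {x y : Bool × (Fin d → Bool)}
    (h : (prism (cubeGraph d)).Adj x y) :
    (cubeGraph (d + 1)).Adj (prismEquivCube e b x) (prismEquivCube e b y) := by
  obtain ⟨a, v⟩ := x
  obtain ⟨a', w⟩ := y
  simp only [prismEquivCube_apply]
  rw [SimpleGraph.boxProd_adj] at h
  rcases h with ⟨h, h'⟩ | ⟨⟨i, hi, hi'⟩, h⟩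
  · obtain rfl : v = w := h'
    refine ⟨e, by simpa using h, ?_⟩
    rw [Fin.forall_iff_succAbove e]
    simp
  · obtain rfl : a = a' := h
    refine ⟨e.succAbove i, by simpa using hi, ?_⟩
    rw [Fin.forall_iff_succAbove e]
    refine ⟨fun _ => by simp, fun k hk => ?_⟩
    simpa using hi' k (fun h => hk (h ▸ rfl))

theorem linkable_cubeGraph (κ : Type*) [Fintype κ] (d : ℕ) :
    Linkable κ (cubeGraph d) (d + 1) := by
  induction d with
  | zero =>
    intro f R _ _ _
    exact links_of_subsingleton fun _ _ v w _ _ => Subsingleton.elim v w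
  | succ d ih =>
    intro f R hf hp ⟨o, j, hj, ho⟩
    by_cases hS : ((coloured f).erase o).Nonempty
    swap
    · rw [Finset.not_nonempty_iff_eq_empty] at hS
      refine links_of_subsingleton fun i hi v w hv hw => absurd hi ?_
      have : v = o := by
        by_contra hne
        have : v ∈ (coloured f).erase o := by simp [mem_coloured, hne, hv]
        simp [hS] at this
      rw [this, ho] at hv
      exact Option.some.inj hv ▸ hj
    -- Moving `x` one step towards `o` brings it closer, so by minimality it reaches an uncoloured
    -- vertex or `o` itself.
    obtain ⟨x, hxS, hmin⟩ := Finset.exists_min_image _ (fun x => hammingDist x o) hS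
    obtain ⟨hxo, hxf⟩ := Finset.mem_erase.1 hxS
    obtain ⟨e, he⟩ := Function.ne_iff.1 hxo
    have hx' : f (Function.update x e (o e)) = none ∨ Function.update x e (o e) = o := by
      by_contra! h
      exact (hmin _ (Finset.mem_erase.2 ⟨h.2, mem_coloured.2 h.1⟩)).not_gt
        (hammingDist_update_lt he)
    have hφo : prismEquivCube e (o e) (false, e.removeNth o) = o := by
      rw [prismEquivCube_apply]
      simp
    have hφx : prismEquivCube e (o e) (true, e.removeNth x) = x := by
      rw [prismEquivCube_apply, Fin.insertNth_eq_iff]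
      refine ⟨?_, rfl⟩
      revert he
      cases x e <;> cases o e <;> simp
    have hφx' : prismEquivCube e (o e) (false, e.removeNth x) = Function.update x e (o e) := by
      rw [prismEquivCube_apply, Fin.insertNth_removeNth]
      simp
    refine Links.congr (prismEquivCube e (o e)) (fun _ _ h => prismEquivCube_adj e (o e) h)
      (links_prism_of_linkable (n := d + 1) (x := e.removeNth x) (o := e.removeNth o) (j := j)
        ih (cubeGraph_preconnected d) ?_ ?_ ?_ ?_ ?_ ?_ hj ?_ ?_)
    · exact fun v => Nat.add_le_add_right (le_card_neighbors_cubeGraph v) 1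
    · simpa using Nat.lt_two_pow_self (n := d)
    · intro hd
      simp only [Fintype.card_pi, Fintype.card_bool, Finset.prod_const, Finset.card_univ,
        Fintype.card_fin]
      obtain ⟨k, rfl⟩ : ∃ k, d = k + 3 := ⟨d - 3, by omega⟩
      have := Nat.lt_two_pow_self (n := k)
      rw [pow_add]
      omega
    · refine le_trans ?_ hf
      refine Finset.card_le_card_of_injOn (prismEquivCube e (o e)) ?_ (Equiv.injective _).injOn
      intro y hy
      have hy' := mem_coloured.1 (Finset.mem_coe.1 hy)
      exact mem_coloured.2 hy'
    · intro i hi x y z hx hy hz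
      simpa using hp i hi _ _ _ hx hy hz
    · rw [Function.comp_apply, hφo, ho]
    · rw [Function.comp_apply, hφx]
      exact mem_coloured.1 hxf
    · rw [Function.comp_apply, hφx']
      refine hx'.imp id fun h => ?_
      have := congrArg e.removeNth h
      simpa using this

end CubeGraph

end CubeLinkage

namespace CubeLinkage

/-! ### Faces of polytopes and the passage to combinatorial cubes. -/

section Polytopes

variable {n m d : ℕ} {P : Set (EuclideanSpace ℝ (Fin n))} {Q : Set (EuclideanSpace ℝ (Fin m))}
  {F : Set (EuclideanSpace ℝ (Fin n))}

theorem IsPolytope.isCompact (hP : IsPolytope P) : IsCompact P := by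
  obtain ⟨X, hX, rfl⟩ := hP
  exact hX.isCompact_convexHull ℝ

theorem IsPolytope.convex (hP : IsPolytope P) : Convex ℝ P := by
  obtain ⟨X, -, rfl⟩ := hP
  exact convex_convexHull ℝ X

/-- Krein–Milman applied to the compact convex set `F`, whose extreme points are extreme in `P`. -/
theorem IsPolytope.face_subset_convexHull (hP : IsPolytope P) (hF : IsExposed ℝ P F)
    {S : Set (EuclideanSpace ℝ (Fin n))} (hS : S.Finite)
    (h : ∀ x ∈ F, x ∈ P.extremePoints ℝ → x ∈ S) : F ⊆ convexHull ℝ S := by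
  rw [← closure_convexHull_extremePoints (hF.isCompact hP.isCompact) (hF.convex hP.convex)]
  refine closure_minimal (convexHull_mono fun x hx => ?_) (hS.isClosed_convexHull ℝ)
  exact h x hx.1 (hF.isExtreme.extremePoints_subset_extremePoints hx)

/-- An extreme point lies outside the hull of the other generators, so a functional separating it
from that hull is maximal on `P` only there. -/
theorem IsPolytope.isExposed_singleton (hP : IsPolytope P) {v : EuclideanSpace ℝ (Fin n)}
    (hv : v ∈ P.extremePoints ℝ) : IsExposed ℝ P {v} := by
  have hPP := hP
  obtain ⟨X, hX, rfl⟩ := hP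
  have hvX : v ∉ convexHull ℝ (X \ {v}) := fun h =>
    ((convex_convexHull ℝ X).mem_extremePoints_iff_mem_sdiff_convexHull_sdiff.1 hv).2
      (convexHull_mono (Set.sdiff_subset_sdiff_left (subset_convexHull ℝ X)) h)
  obtain ⟨l, a, hl, ha⟩ := geometric_hahn_banach_closed_point (convex_convexHull ℝ (X \ {v}))
    (hX.sdiff.isClosed_convexHull ℝ) hvX
  have hlX : ∀ x ∈ X, x = v ∨ l x < l v := by
    intro x hx
    by_cases hxv : x = v
    · exact .inl hxv
    · exact .inr ((hl x (subset_convexHull ℝ _ ⟨hx, hxv⟩)).trans ha)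
  have hmax : ∀ y ∈ convexHull ℝ X, l y ≤ l v := by
    intro y hy
    refine convexHull_min (t := {z | l z ≤ l v}) (fun x hx => ?_)
      (convex_halfSpace_le l.toLinearMap.isLinear _) hy
    rcases hlX x hx with rfl | h
    · exact le_refl (l x)
    · exact h.le
  have hE : IsExposed ℝ (convexHull ℝ X) (l.toExposed (convexHull ℝ X)) :=
    ContinuousLinearMap.toExposed.isExposed
  have hsub : l.toExposed (convexHull ℝ X) ⊆ {v} := by
    rw [← convexHull_singleton (𝕜 := ℝ) v]
    refine hPP.face_subset_convexHull hE (Set.finite_singleton v) fun x hx hxe => ?_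
    rcases hlX x (extremePoints_convexHull_subset hxe) with h | h
    · exact h
    · exact absurd (hx.2 v hv.1) h.not_ge
  have : l.toExposed (convexHull ℝ X) = {v} :=
    hsub.antisymm (Set.singleton_subset_iff.2 ⟨hv.1, hmax⟩)
  exact this ▸ hE

theorem IsPolytope.exists_vertex_mem (hP : IsPolytope P) (hF : IsExposed ℝ P F)
    (hne : F.Nonempty) : ∃ v : Vertex P, v.1 ∈ F := by
  obtain ⟨x, hx⟩ := (hF.isCompact hP.isCompact).extremePoints_nonempty hne
  exact ⟨⟨x, hP.isExposed_singleton (hF.isExtreme.extremePoints_subset_extremePoints hx)⟩, hx.1⟩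

theorem IsPolytope.face_eq_segment (hP : IsPolytope P) (hF : IsExposed ℝ P F) {u v : Vertex P}
    (hu : u.1 ∈ F) (hv : v.1 ∈ F) (h : ∀ w : Vertex P, w.1 ∈ F → w = u ∨ w = v) :
    F = segment ℝ u.1 v.1 := by
  refine Set.Subset.antisymm ?_ ((hF.convex hP.convex).segment_subset hu hv)
  rw [← convexHull_pair]
  refine hP.face_subset_convexHull hF (Set.toFinite _) fun x hx hxe => ?_
  rcases h ⟨x, hP.isExposed_singleton hxe⟩ hx with h | h
  · exact .inl (congrArg Subtype.val h)
  · exact .inr (congrArg Subtype.val h)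

/-- The face consisting of a vertex. -/
def Vertex.face (v : Vertex P) : Face P := ⟨{v.1}, v.2⟩

theorem Vertex.face_le {v : Vertex P} {E : Face P} : face v ≤ E ↔ v.1 ∈ E.1 :=
  Set.singleton_subset_iff

theorem Vertex.face_injective : Function.Injective (face : Vertex P → Face P) :=
  fun _ _ h => Subtype.ext (Set.singleton_injective (congrArg Subtype.val h))

theorem face_apply_eq_empty (φ : Face P ≃o Face Q) {E : Face P} (h : E.1 = ∅) :
    (φ E).1 = ∅ := by
  have h1 : E ≤ φ.symm ⟨∅, isExposed_empty⟩ := by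
    change E.1 ⊆ _
    simp [h]
  have h2 : φ E ≤ ⟨∅, isExposed_empty⟩ := by simpa using φ.monotone h1
  exact Set.subset_empty_iff.1 h2

theorem face_apply_nonempty (φ : Face P ≃o Face Q) {E : Face P} (h : E.1.Nonempty) :
    (φ E).1.Nonempty := by
  rw [Set.nonempty_iff_ne_empty] at h ⊢
  intro h'
  exact h (by simpa using face_apply_eq_empty φ.symm h')

/-- An isomorphism of face lattices maps vertices to vertices. -/
theorem exists_vertex_face_eq (hQ : IsPolytope Q) (φ : Face P ≃o Face Q) (v : Vertex P) :
    ∃ w : Vertex Q, φ (Vertex.face v) = Vertex.face w := by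
  obtain ⟨w, hw⟩ := hQ.exists_vertex_mem (φ (Vertex.face v)).2
    (face_apply_nonempty φ (Set.singleton_nonempty v.1))
  refine ⟨w, ?_⟩
  -- Vertices are minimal among nonempty faces, and the isomorphism preserves nonemptiness.
  have h1 : φ.symm (Vertex.face w) ≤ Vertex.face v := by
    simpa using φ.symm.monotone (Vertex.face_le.2 hw)
  have h2 : φ.symm (Vertex.face w) = Vertex.face v := by
    refine Subtype.ext ((Set.subset_singleton_iff_eq.1 h1).resolve_left ?_)
    exact (face_apply_nonempty φ.symm (Set.singleton_nonempty w.1)).ne_empty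
  rw [← h2, OrderIso.apply_symm_apply]

/-! ### The standard cube -/

/-- The value `1` or `-1`. -/
def sign (b : Bool) : ℝ := bif b then 1 else -1

/-- The vertices of the standard cube. -/
def signVector (x : Fin d → Bool) : EuclideanSpace ℝ (Fin d) := WithLp.toLp 2 fun i => sign (x i)

theorem signVector_apply (x : Fin d → Bool) (i : Fin d) : signVector x i = sign (x i) := rfl

theorem exists_eq_signVector {v : EuclideanSpace ℝ (Fin d)} (hv : ∀ i, v i = 1 ∨ v i = -1) :
    ∃ x, v = signVector x := by
  refine ⟨fun i => decide (v i = 1), ?_⟩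
  ext i
  rw [signVector_apply]
  rcases hv i with h | h <;> rw [h] <;> norm_num [sign]

theorem signVector_mem (x : Fin d → Bool) : signVector x ∈ standardCube d :=
  subset_convexHull ℝ _ fun i => by
    rw [signVector_apply]
    cases x i <;> simp [sign]

theorem isPolytope_standardCube (d : ℕ) : IsPolytope (standardCube d) := by
  refine ⟨_, (Set.finite_range (signVector (d := d))).subset ?_, rfl⟩
  intro v hv
  obtain ⟨x, rfl⟩ := exists_eq_signVector hv
  exact ⟨x, rfl⟩

theorem exists_signVector_of_vertex (v : Vertex (standardCube d)) : ∃ x, v.1 = signVector x :=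
  exists_eq_signVector (extremePoints_convexHull_subset (𝕜 := ℝ)
    (isExtreme_singleton.1 v.2.isExtreme))

/-- The functional `∑ i ∈ T, sign (x i) * v i` is at most `T.card` on the cube, and a sign vector
attains this bound exactly when each summand is `1`. -/
theorem exists_face_standardCube (x : Fin d → Bool) (T : Finset (Fin d)) :
    ∃ E : Face (standardCube d), ∀ y, signVector y ∈ E.1 ↔ ∀ i ∈ T, y i = x i := by
  set l : StrongDual ℝ (EuclideanSpace ℝ (Fin d)) :=
    ∑ i ∈ T, sign (x i) • (EuclideanSpace.proj i : StrongDual ℝ (EuclideanSpace ℝ (Fin d))) with hl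
  have hlv : ∀ v, l v = ∑ i ∈ T, sign (x i) * v i := by
    intro v
    simp [hl]
  have hle : ∀ a b : Bool, sign a * sign b ≤ 1 := by
    intro a b
    cases a <;> cases b <;> norm_num [sign]
  have heq : ∀ a b : Bool, sign a * sign b = 1 ↔ b = a := by
    intro a b
    cases a <;> cases b <;> norm_num [sign]
  have hx : l (signVector x) = T.card := by
    rw [hlv, Finset.card_eq_sum_ones, Nat.cast_sum]
    exact Finset.sum_congr rfl fun i _ => by simp [signVector_apply, (heq _ _).2]
  have hmax : ∀ v ∈ standardCube d, l v ≤ T.card := by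
    intro v hv
    refine convexHull_min (t := {z | l z ≤ T.card}) (fun z hz => ?_)
      (convex_halfSpace_le l.toLinearMap.isLinear _) hv
    obtain ⟨y, rfl⟩ := exists_eq_signVector hz
    rw [Set.mem_ofPred_eq, hlv, Finset.card_eq_sum_ones, Nat.cast_sum]
    exact Finset.sum_le_sum fun i _ => by simpa [signVector_apply] using hle _ _
  refine ⟨⟨l.toExposed (standardCube d), ContinuousLinearMap.toExposed.isExposed⟩, fun y => ?_⟩
  have h1 : signVector y ∈ l.toExposed (standardCube d) ↔ l (signVector y) = T.card := by
    constructor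
    · intro h
      exact le_antisymm (hmax _ h.1) (hx ▸ h.2 _ (signVector_mem x))
    · intro h
      exact ⟨signVector_mem y, fun z hz => h ▸ hmax z hz⟩
  change signVector y ∈ l.toExposed (standardCube d) ↔ _
  rw [h1, hlv, Finset.card_eq_sum_ones, Nat.cast_sum]
  simp only [signVector_apply, Nat.cast_one]
  rw [Finset.sum_eq_sum_iff_of_le fun i _ => hle _ _]
  exact forall₂_congr fun i _ => heq _ _

theorem isExposed_signVector (x : Fin d → Bool) : IsExposed ℝ (standardCube d) {signVector x} := by
  obtain ⟨E, hE⟩ := exists_face_standardCube x Finset.univ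
  obtain ⟨v, hv⟩ := (isPolytope_standardCube d).exists_vertex_mem E.2
    ⟨_, (hE x).2 fun _ _ => rfl⟩
  obtain ⟨y, hy⟩ := exists_signVector_of_vertex v
  have : y = x := funext fun i => (hE y).1 (hy ▸ hv) i (Finset.mem_univ i)
  rw [← this, ← hy]
  exact v.2

theorem signVector_injective : Function.Injective (signVector (d := d)) := by
  intro x y h
  obtain ⟨E, hE⟩ := exists_face_standardCube y Finset.univ
  have : signVector x ∈ E.1 := h ▸ (hE y).2 fun _ _ => rfl
  exact funext fun i => (hE x).1 this i (Finset.mem_univ i)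

/-- The graph of a `d`-cube contains the graph of `{0, 1}ᵈ` as a spanning subgraph. -/
theorem IsCube.exists_equiv (hP : IsCube d P) : ∃ ψ : (Fin d → Bool) ≃ Vertex P,
    ∀ x y, (cubeGraph d).Adj x y → (graph P).Adj (ψ x) (ψ y) := by
  obtain ⟨hP, ⟨φ⟩⟩ := hP
  have hC := isPolytope_standardCube d
  choose ψ hψ using fun x : Fin d → Bool =>
    exists_vertex_face_eq hP φ.symm ⟨signVector x, isExposed_signVector x⟩
  have hmem : ∀ x (E : Face P), (ψ x).1 ∈ E.1 ↔ signVector x ∈ (φ E).1 := by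
    intro x E
    rw [← Vertex.face_le, ← hψ, OrderIso.symm_apply_le, Vertex.face_le]
  have hinj : Function.Injective ψ := by
    intro x y hxy
    have h := (hψ x).trans (hxy ▸ (hψ y).symm)
    exact signVector_injective
      (congrArg Subtype.val (Vertex.face_injective (φ.symm.injective h)))
  have hsurj : Function.Surjective ψ := by
    intro v
    obtain ⟨w, hw⟩ := exists_vertex_face_eq hC φ v
    obtain ⟨x, hx⟩ := exists_signVector_of_vertex w
    obtain rfl : w = ⟨signVector x, isExposed_signVector x⟩ := Subtype.ext hx
    refine ⟨x, Vertex.face_injective ?_⟩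
    rw [← hψ, ← hw, OrderIso.symm_apply_apply]
  refine ⟨Equiv.ofBijective ψ ⟨hinj, hsurj⟩, ?_⟩
  rintro x y ⟨e, he, hxy⟩
  have hne : ψ x ≠ ψ y := fun h => he (congrFun (hinj h) e)
  refine ⟨hne, ?_⟩
  -- Fixing all coordinates but `e` leaves the sign vectors of `x` and `y` only; the corresponding
  -- face of `P` thus has two vertices and is the segment between them.
  obtain ⟨E, hE⟩ := exists_face_standardCube x (Finset.univ.erase e)
  have hφ : ∀ z, (ψ z).1 ∈ (φ.symm E).1 ↔ ∀ i ∈ Finset.univ.erase e, z i = x i := by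
    intro z
    rw [hmem, OrderIso.apply_symm_apply, hE]
  have hseg : (φ.symm E).1 = segment ℝ (ψ x).1 (ψ y).1 := by
    refine hP.face_eq_segment (φ.symm E).2 ((hφ x).2 fun _ _ => rfl)
      ((hφ y).2 fun i hi => (hxy i (Finset.ne_of_mem_erase hi)).symm) fun w hw => ?_
    obtain ⟨z, rfl⟩ := hsurj w
    rw [hφ] at hw
    by_cases hz : z e = x e
    · left
      congr 1
      funext i
      by_cases hi : i = e
      · rw [hi, hz]
      · exact hw i (by simp [hi])
    · right
      congr 1
      funext i
      by_cases hi : i = e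
      · subst hi
        revert hz he
        cases z i <;> cases x i <;> cases y i <;> simp
      · rw [hw i (by simp [hi]), hxy i hi]
  exact hseg ▸ (φ.symm E).2

end Polytopes

/-! ### From linkable colourings to strong linkedness. -/

section StronglyLinked

open scoped Classical

theorem stronglyLinked_of_equiv_cube {V : Type*} {G : SimpleGraph V} {d : ℕ}
    (ψ : (Fin d → Bool) ≃ V) (hψ : ∀ x y, (cubeGraph d).Adj x y → G.Adj (ψ x) (ψ y)) :
    IsStronglyLinked G (d / 2) := by
  have hcard : ENat.card V = ((2 ^ d : ℕ) : ℕ∞) := by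
    rw [← ENat.card_congr ψ, ENat.card_eq_coe_fintype_card]
    simp
  have hd : 2 * (d / 2) + 1 ≤ 2 ^ d := by
    have := Nat.lt_two_pow_self (n := d)
    omega
  refine ⟨by rw [hcard]; exact_mod_cast hd, fun v => ⟨?_, fun s t hst => ?_⟩⟩
  · have : Fintype V := Fintype.ofEquiv _ ψ
    rw [ENat.card_eq_coe_fintype_card] at hcard ⊢
    have h1 : Fintype.card V = 2 ^ d := by exact_mod_cast hcard
    have h2 : Fintype.card ({v}ᶜ : Set V) = Fintype.card V - 1 := by
      rw [Fintype.card_compl_set, Set.card_singleton]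
    norm_cast
    omega
  have hs : ∀ i k, s i = s k → i = k := fun i k h => by
    simpa using hst (a₁ := .inl i) (a₂ := .inl k) h
  have ht : ∀ i k, t i = t k → i = k := fun i k h => by
    simpa using hst (a₁ := .inr i) (a₂ := .inr k) h
  have hne : ∀ i k, s i ≠ t k := fun i k h => by
    simpa using hst (a₁ := .inl i) (a₂ := .inr k) h
  -- The outer `none` means uncoloured; the colour `none` is reserved for the deleted vertex `v`,
  -- the obstacle.
  set f : (Fin d → Bool) → Option (Option (Fin (d / 2))) := fun x =>
    if ψ x = v then some none
    else if h : ∃ i, ψ x = s i ∨ ψ x = t i then some (some h.choose) else none with hf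
  have hfi : ∀ x i, f x = some (some i) ↔ ψ x = s i ∨ ψ x = t i := by
    intro x i
    by_cases hv : ψ x = v
    · simp only [hf, hv, if_true]
      refine ⟨fun h => by simp at h, fun h => ?_⟩
      rcases h with h | h
      · exact absurd h.symm (s i).2
      · exact absurd h.symm (t i).2
    · by_cases h : ∃ i, ψ x = s i ∨ ψ x = t i
      · simp only [hf, hv, if_false, dif_pos h, Option.some.injEq]
        refine ⟨fun hi => hi ▸ h.choose_spec, fun hi => ?_⟩
        rcases h.choose_spec with h1 | h1 <;> rcases hi with h2 | h2
        · exact hs _ _ (Subtype.ext (h1.symm.trans h2))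
        · exact absurd (Subtype.ext (h1.symm.trans h2)) (hne _ _)
        · exact absurd (Subtype.ext (h2.symm.trans h1)) (hne _ _)
        · exact ht _ _ (Subtype.ext (h1.symm.trans h2))
      · simp only [hf, hv, if_false, dif_neg h]
        exact ⟨fun h => by simp at h, fun hi => absurd ⟨i, hi⟩ h⟩
  have hfv : f (ψ.symm v) = some none := by simp [hf]
  have hfc : (coloured f).card ≤ d + 1 := by
    have hsub : coloured f ⊆ insert (ψ.symm v) (Finset.univ.image fun i => ψ.symm (s i)) ∪
        Finset.univ.image fun i => ψ.symm (t i) := by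
      intro x hx
      rw [mem_coloured] at hx
      simp only [Finset.mem_union, Finset.mem_insert, Finset.mem_image, Finset.mem_univ,
        true_and, Equiv.symm_apply_eq]
      by_cases hv : ψ x = v
      · exact .inl (.inl (hv.symm ▸ (ψ.symm_apply_apply x).symm))
      · by_cases h : ∃ i, ψ x = s i ∨ ψ x = t i
        · obtain ⟨i, h | h⟩ := h
          · exact .inl (.inr ⟨i, h.symm⟩)
          · exact .inr ⟨i, h.symm⟩
        · simp [hf, hv, h] at hx
    have h1 := Finset.card_le_card hsub
    have h2 := Finset.card_union_le (insert (ψ.symm v) (Finset.univ.image fun i => ψ.symm (s i)))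
      (Finset.univ.image fun i => ψ.symm (t i))
    have h3 := Finset.card_insert_le (ψ.symm v) (Finset.univ.image fun i => ψ.symm (s i))
    have h4 : (Finset.univ.image fun i => ψ.symm (s i).1).card ≤ d / 2 := by
      simpa using Finset.card_image_le (s := Finset.univ) (f := fun i => ψ.symm (s i).1)
    have h5 : (Finset.univ.image fun i => ψ.symm (t i).1).card ≤ d / 2 := by
      simpa using Finset.card_image_le (s := Finset.univ) (f := fun i => ψ.symm (t i).1)
    omega
  obtain ⟨c, hc, hl⟩ := linkable_cubeGraph (Option (Fin (d / 2))) d f {i | i ≠ none} hfc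
    (by
      rintro (_ | i) hi x y z hx hy hz
      · exact absurd rfl hi
      rw [hfi] at hx hy hz
      have key : ∀ {x y : Fin d → Bool} {a : V}, ψ x = a → ψ y = a → x = y :=
        fun h h' => ψ.injective (h.trans h'.symm)
      rcases hx with hx | hx <;> rcases hy with hy | hy <;> rcases hz with hz | hz <;>
        first
          | exact .inl (key hx hy)
          | exact .inr (.inl (key hx hz))
          | exact .inr (.inr (key hy hz)))
    ⟨_, none, by simp, hfv⟩
  have hw : ∀ i, ∃ p : (G.induce ({v}ᶜ : Set V)).Walk (s i) (t i),
      ∀ x ∈ p.support, c (ψ.symm x) = some (some i) := by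
    intro i
    have h := (hl (some i) (by simp) (ψ.symm (s i)) (ψ.symm (t i))
      ((hfi _ _).2 (by simp)) ((hfi _ _).2 (by simp))).map
      (T := {x | c (ψ.symm x) = some (some i)}) (H := G) ⟨ψ, fun {a b} h => hψ a b h⟩ (by
        intro x hx
        simpa using hx)
    obtain ⟨p, hp⟩ : JoinedWithin G {x | c (ψ.symm x) = some (some i)} (s i) (t i) := by
      simpa using h
    -- The extended colouring keeps the obstacle colour at `v`, so a walk of colour `some i` misses
    -- `v`.
    have hpv : ∀ x ∈ p.support, x ∈ ({v}ᶜ : Set V) := by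
      rintro x hx rfl
      have := hp x hx
      rw [Set.mem_ofPred_eq, hc _ _ hfv] at this
      simp at this
    refine ⟨p.induce _ hpv, fun x hx => ?_⟩
    rw [SimpleGraph.Walk.support_induce] at hx
    exact hp x.1 ((List.mem_attachWith ..).1 hx)
  choose p hp using hw
  refine ⟨fun i => (p i).toPath, fun i k hik x hx hx' => hik ?_⟩
  have h1 := hp i x ((p i).support_toPath_subset_support hx)
  have h2 := hp k x ((p k).support_toPath_subset_support hx')
  simpa using h1.symm.trans h2

end StronglyLinked

end CubeLinkage

theorem mainTheorem3 (d : ℕ) (hd : 1 ≤ d) (n : ℕ) (P : Set (EuclideanSpace ℝ (Fin n)))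
    (hP : CubeLinkage.IsCube d P) :
    CubeLinkage.IsStronglyLinked (CubeLinkage.graph P) (d / 2) := by
  obtain ⟨ψ, hψ⟩ := hP.exists_equiv
  exact CubeLinkage.stronglyLinked_of_equiv_cube ψ hψ
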